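/- Let $\mathbb{R}^{0,2,1}$ denote $\mathbb{R}^3$ with its canonical coordinates $(x,y,z)$ and the degenerate metric $dx^2+dy^2$. Let $(M,g)$ be a connected, two-dimensional, complete smooth Riemannian manifold (without boundary), and let $f:(M,g)\to\mathbb{R}^{0,2,1}$ be an isometric immersion, i.e. a $C^\infty$ immersion $f:M\to\mathbb{R}^3$ with $f^*(dx^2+dy^2)=g$. Then: (i) $(M,g)$ is isometric to the Euclidean plane $\mathbb{R}^2$, i.e. there is a $C^\infty$ diffeomorphism $\Phi:M\to\mathbb{R}^2$ with $\Phi^*(du^2+dv^2)=g$; and (ii) there is a $C^\infty$ function $F:\mathbb{R}^2\to\mathbb{R}$, defined on all of $\mathbb{R}^2$, such that the image of $f$ is the entire graph $$f(M)=\{(u,v,F(u,v)) : (u,v)\in\mathbb{R}^2\}.$$ -/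

import Mathlib

open Bundle
open scoped Manifold ContDiff

noncomputable section

namespace SingularSemiEuclidean

-- Makes instance search use the identity chart on the vector spaces `ℝ²` and `ℝ³` directly.
attribute [local instance 2000] chartedSpaceSelf

/-- The smooth manifold `ℝ³` underlying the singular semi-Euclidean space `ℝ^{0,2,1}`, with
canonical coordinates `(x, y, z) = (p 0, p 1, p 2)`. The Euclidean norm of this type only provides
the standard smooth structure; the metric of `ℝ^{0,2,1}` is `degenerateMetric`. -/
abbrev R021 : Type := EuclideanSpace ℝ (Fin 3)

/-- The degenerate metric `dx² + dy²` of `ℝ^{0,2,1}`, on each tangent space `T_p ℝ³`. -/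
def degenerateMetric (p : R021) (v w : TangentSpace (𝓡 3) p) : ℝ :=
  letI V : R021 := v
  letI W : R021 := w
  V 0 * W 0 + V 1 * W 1

section

variable {M : Type*} [TopologicalSpace M] [ChartedSpace (EuclideanSpace ℝ (Fin 2)) M]
  [IsManifold (𝓡 2) ∞ M] [RiemannianBundle (fun x : M ↦ TangentSpace (𝓡 2) x)]

/-- `f : (M, g) → ℝ^{0,2,1}` is an isometric immersion of the Riemannian surface `(M, g)`: a `C^∞`
map with injective differentials which pulls the degenerate metric `dx² + dy²` back to `g`. -/
structure IsIsometricImmersion (f : M → R021) : Prop where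
  contMDiff : ContMDiff (𝓡 2) (𝓡 3) ∞ f
  injective_mfderiv : ∀ x : M, Function.Injective (mfderiv (𝓡 2) (𝓡 3) f x)
  pullback_eq : ∀ (x : M) (v w : TangentSpace (𝓡 2) x),
    degenerateMetric (f x) (mfderiv (𝓡 2) (𝓡 3) f x v) (mfderiv (𝓡 2) (𝓡 3) f x w) = inner ℝ v w

variable (M) in
/-- `(M, g)` is isometric to the Euclidean plane `ℝ²`: there is a `C^∞` diffeomorphism `M → ℝ²`
which pulls the Euclidean metric of `ℝ²` back to `g`. -/
def IsIsometricToEuclideanPlane : Prop :=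
  ∃ Φ : M ≃ₘ^∞⟮𝓡 2, 𝓡 2⟯ EuclideanSpace ℝ (Fin 2),
    ∀ (x : M) (v w : TangentSpace (𝓡 2) x),
      inner ℝ (mfderiv (𝓡 2) (𝓡 2) Φ x v) (mfderiv (𝓡 2) (𝓡 2) Φ x w) = inner ℝ v w

end

/-- The entire graph `{(u, v, F(u, v)) | (u, v) ∈ ℝ²}` in `ℝ^{0,2,1}`. -/
def entireGraph (F : EuclideanSpace ℝ (Fin 2) → ℝ) : Set R021 :=
  {p | ∃ u v : ℝ, p = !₂[u, v, F !₂[u, v]]}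

end SingularSemiEuclidean

end

noncomputable section

open Set Filter Topology MeasureTheory

namespace LocalIsometry

attribute [local instance 2000] chartedSpaceSelf

section InverseFunction

variable {E : Type*} [NormedAddCommGroup E] [NormedSpace ℝ E]
  {M : Type*} [TopologicalSpace M] [ChartedSpace E M]

/-- Near every point, `p` is a homeomorphism onto an open set, with an inverse that is smooth at
the image of that point. -/
def HasSmoothLocalInverses (p : M → E) : Prop :=
  ∀ x : M, ∃ e : OpenPartialHomeomorph M E, x ∈ e.source ∧ EqOn p e e.source ∧
    ContMDiffAt 𝓘(ℝ, E) 𝓘(ℝ, E) ∞ e.symm (p x)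

theorem HasSmoothLocalInverses.isLocalHomeomorph {p : M → E} (hp : HasSmoothLocalInverses p) :
    IsLocalHomeomorph p :=
  IsLocalHomeomorph.mk p fun x ↦ let ⟨e, hx, he, _⟩ := hp x; ⟨e, hx, he⟩

/-- The inverse function theorem for a smooth map from a manifold to its model vector space. -/
theorem hasSmoothLocalInverses_of_isInvertible_mfderiv [CompleteSpace E]
    [IsManifold 𝓘(ℝ, E) ∞ M] {p : M → E}
    (hp : ContMDiff 𝓘(ℝ, E) 𝓘(ℝ, E) ∞ p)
    (hp' : ∀ x, (mfderiv 𝓘(ℝ, E) 𝓘(ℝ, E) p x).IsInvertible) :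
    HasSmoothLocalInverses p := by
  intro x
  set φ := chartAt E x
  have hxφ : x ∈ φ.source := mem_chart_source E x
  have hg : ContDiffAt ℝ ∞ (p ∘ φ.symm) (φ x) := by
    have h := (contMDiffAt_iff.1 (hp x)).2
    rw [ModelWithCorners.range_eq_univ, contDiffWithinAt_univ] at h
    exact h
  obtain ⟨A, hA⟩ := hp' x
  let B : E ≃L[ℝ] E := A
  have hd : HasFDerivAt (p ∘ φ.symm) (B : E →L[ℝ] E) (φ x) := by
    have h := ((hp x).mdifferentiableAt (by simp)).hasMFDerivAt.2
    rw [← hA, ModelWithCorners.range_eq_univ] at h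
    exact hasFDerivWithinAt_univ.1 h
  have hgx : (p ∘ φ.symm) (φ x) = p x := by simp [φ.left_inv hxφ]
  have hinf : (∞ : WithTop ℕ∞) ≠ 0 := by simp
  refine ⟨φ.trans (hg.toOpenPartialHomeomorph (p ∘ φ.symm) hd hinf), ?_, ?_, ?_⟩
  · simpa [OpenPartialHomeomorph.trans_source, hxφ] using
      hg.mem_toOpenPartialHomeomorph_source hd hinf
  · intro y hy
    have hy' : y ∈ φ.source := by
      rw [OpenPartialHomeomorph.trans_source] at hy
      exact hy.1
    simp [φ.left_inv hy']
  · have h1 : ContDiffAt ℝ ∞ (hg.toOpenPartialHomeomorph (p ∘ φ.symm) hd hinf).symm (p x) := by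
      have := hg.to_localInverse hd hinf
      rw [hgx] at this
      exact this
    have h2 : (hg.toOpenPartialHomeomorph (p ∘ φ.symm) hd hinf).symm (p x) = φ x := by
      have := (hg.toOpenPartialHomeomorph (p ∘ φ.symm) hd hinf).left_inv
        (hg.mem_toOpenPartialHomeomorph_source hd hinf)
      rwa [hg.toOpenPartialHomeomorph_coe, hgx] at this
    have h3 : ContMDiffAt 𝓘(ℝ, E) 𝓘(ℝ, E) ∞ φ.symm
        ((hg.toOpenPartialHomeomorph (p ∘ φ.symm) hd hinf).symm (p x)) := by
      rw [h2]
      exact (contMDiffOn_chart_symm (I := 𝓘(ℝ, E)) (x := x)).contMDiffAt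
        (φ.open_target.mem_nhds (φ.map_source hxφ))
    exact h3.comp (p x) h1.contMDiffAt

/-- A continuous lift of a smooth map through a local diffeomorphism is smooth. -/
theorem HasSmoothLocalInverses.contMDiffWithinAt_lift {p : M → E} (hp : HasSmoothLocalInverses p)
    {V : Type*} [NormedAddCommGroup V] [NormedSpace ℝ V] {σ : V → M} {s : Set V} {t : V}
    (hσ : ContinuousWithinAt σ s t) (hpσ : ContDiffWithinAt ℝ ∞ (p ∘ σ) s t) :
    ContMDiffWithinAt 𝓘(ℝ, V) 𝓘(ℝ, E) ∞ σ s t := by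
  obtain ⟨e, hxe, hpe, he⟩ := hp (σ t)
  have h1 : ContMDiffWithinAt 𝓘(ℝ, V) 𝓘(ℝ, E) ∞ (e.symm ∘ (p ∘ σ)) s t :=
    he.comp_contMDiffWithinAt t hpσ.contMDiffWithinAt
  refine h1.congr_of_eventuallyEq ?_ ?_
  · filter_upwards [hσ (e.open_source.mem_nhds hxe)] with a ha
    simp [hpe ha, e.left_inv ha]
  · simp [hpe hxe, e.left_inv hxe]

end InverseFunction

section Lifting

/-- Lifts of segments through a local homeomorphism extend a bit beyond the end point. -/
theorem exists_lift_extension {E : Type*} [NormedAddCommGroup E] [NormedSpace ℝ E]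
    {X : Type*} [TopologicalSpace X] {p : X → E} (hloc : IsLocalHomeomorph p)
    {γ : ℝ → X} {T y : ℝ} (hT : 0 ≤ T) (hy : T < y) (hγ : ContinuousOn γ (Icc 0 T)) {c w : E}
    (hl : ∀ t ∈ Icc 0 T, p (γ t) = c + t • w) :
    ∃ T' ∈ Ioc T y, ∃ γ' : ℝ → X, ContinuousOn γ' (Icc 0 T') ∧ γ' 0 = γ 0 ∧
      ∀ t ∈ Icc 0 T', p (γ' t) = c + t • w := by
  obtain ⟨e, hxe, rfl⟩ := hloc (γ T)
  have hTT : T ∈ Icc 0 T := right_mem_Icc.2 hT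
  have hc : Continuous fun s : ℝ ↦ c + s • w := by fun_prop
  have hmem : ∀ᶠ s in 𝓝 T, c + s • w ∈ e.target := by
    refine hc.continuousAt (e.open_target.mem_nhds ?_)
    rw [← hl T hTT]
    exact e.map_source hxe
  obtain ⟨u, hu, hsub⟩ := (mem_nhdsGE_iff_exists_mem_Ioc_Ico_subset hy).1
    (mem_nhdsWithin_of_mem_nhds hmem)
  obtain ⟨T', hTT', hT'u⟩ := exists_between hu.1
  have hT' : T' ∈ Ioc T y := ⟨hTT', hT'u.le.trans hu.2⟩
  have hsub' : ∀ t ∈ Icc T T', c + t • w ∈ e.target :=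
    fun t ht ↦ hsub ⟨ht.1, ht.2.trans_lt hT'u⟩
  have hr : EqOn (fun t ↦ if t ≤ T then γ t else e.symm (c + t • w))
      (fun t ↦ e.symm (c + t • w)) (Icc T T') := by
    intro t ht
    rcases ht.1.eq_or_lt with rfl | h
    · simp [← hl T hTT, e.left_inv hxe]
    · simp [h.not_ge]
  have hle : EqOn (fun t ↦ if t ≤ T then γ t else e.symm (c + t • w)) γ (Icc 0 T) :=
    fun t ht ↦ if_pos ht.2
  refine ⟨T', hT', fun t ↦ if t ≤ T then γ t else e.symm (c + t • w), ?_, if_pos hT, ?_⟩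
  · rw [← Icc_union_Icc_eq_Icc hT hT'.1.le]
    refine ContinuousOn.union_of_isClosed (hγ.congr hle) (ContinuousOn.congr ?_ hr)
      isClosed_Icc isClosed_Icc
    exact e.continuousOn_symm.comp hc.continuousOn hsub'
  · intro t ht
    rcases le_total t T with h | h
    · exact (congrArg e (hle ⟨ht.1, h⟩)).trans (hl t ⟨ht.1, h⟩)
    · exact (congrArg e (hr ⟨h, ht.2⟩)).trans (e.right_inv (hsub' t ⟨h, ht.2⟩))

variable {E : Type*} [NormedAddCommGroup E] [InnerProductSpace ℝ E]
  {M : Type*} [EMetricSpace M] [ChartedSpace E M]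
  [RiemannianBundle (fun x : M ↦ TangentSpace 𝓘(ℝ, E) x)] [IsRiemannianManifold 𝓘(ℝ, E) M]

/-- A lift of a line through a local isometry does not increase distances. -/
theorem edist_le_of_lift_line {p : M → E} (hp : ContMDiff 𝓘(ℝ, E) 𝓘(ℝ, E) ∞ p)
    (hloc : HasSmoothLocalInverses p)
    (hnorm : ∀ (x : M) (v : TangentSpace 𝓘(ℝ, E) x),
      ‖mfderiv 𝓘(ℝ, E) 𝓘(ℝ, E) p x v‖ = ‖v‖)
    {γ : ℝ → M} {a b : ℝ} (hab : a ≤ b) (hγ : ContinuousOn γ (Icc a b)) {c w : E}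
    (hl : ∀ t ∈ Icc a b, p (γ t) = c + t • w) :
    edist (γ a) (γ b) ≤ ENNReal.ofReal (‖w‖ * (b - a)) := by
  have hlin : ContDiff ℝ ∞ (fun t : ℝ ↦ c + t • w) := by fun_prop
  have hsm : ContMDiffOn 𝓘(ℝ, ℝ) 𝓘(ℝ, E) ∞ γ (Icc a b) := fun t ht ↦
    hloc.contMDiffWithinAt_lift (hγ t ht)
      (hlin.contDiffWithinAt.congr (fun s hs ↦ hl s hs) (hl t ht))
  rw [IsRiemannianManifold.out (I := 𝓘(ℝ, E)) (γ a) (γ b)]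
  refine (Manifold.riemannianEDist_le_pathELength (hsm.of_le (by simp)) rfl rfl hab).trans ?_
  rw [Manifold.pathELength_eq_lintegral_mfderiv_Ioo]
  have key : ∀ t ∈ Ioo a b, ‖mfderiv 𝓘(ℝ, ℝ) 𝓘(ℝ, E) γ t 1‖ₑ = ENNReal.ofReal ‖w‖ := by
    intro t ht
    have hγt : MDifferentiableAt 𝓘(ℝ, ℝ) 𝓘(ℝ, E) γ t :=
      ((hsm t (Ioo_subset_Icc_self ht)).contMDiffAt (Icc_mem_nhds ht.1 ht.2)).mdifferentiableAt
        (by simp)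
    have hpt : MDifferentiableAt 𝓘(ℝ, E) 𝓘(ℝ, E) p (γ t) :=
      (hp (γ t)).mdifferentiableAt (by simp)
    have h1 := mfderiv_comp t hpt hγt
    have h2 : p ∘ γ =ᶠ[𝓝 t] fun t ↦ c + t • w := by
      filter_upwards [Icc_mem_nhds ht.1 ht.2] with s hs using hl s hs
    have h3 : HasFDerivAt (fun t : ℝ ↦ c + t • w) (ContinuousLinearMap.toSpanSingleton ℝ w) t := by
      have := ((hasDerivAt_id t).smul_const w).const_add c
      simpa [hasDerivAt_iff_hasFDerivAt] using this
    rw [h2.mfderiv_eq, mfderiv_eq_fderiv, h3.fderiv] at h1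
    have h4 : mfderiv 𝓘(ℝ, E) 𝓘(ℝ, E) p (γ t) (mfderiv 𝓘(ℝ, ℝ) 𝓘(ℝ, E) γ t 1) = w :=
      (congrArg (fun L : ℝ →L[ℝ] E ↦ L 1) h1).symm.trans (by simp)
    rw [← ofReal_norm, ← hnorm, norm_tangentSpace_vectorSpace]
    exact congrArg (fun v : E ↦ ENNReal.ofReal ‖v‖) h4
  rw [setLIntegral_congr_fun measurableSet_Ioo key]
  simp [ENNReal.ofReal_mul]

/-- Lifts of half-open segments through a local isometry extend to the end point. -/
theorem exists_lift_Icc_of_lift_Ico [CompleteSpace M] {p : M → E}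
    (hp : ContMDiff 𝓘(ℝ, E) 𝓘(ℝ, E) ∞ p) (hloc : HasSmoothLocalInverses p)
    (hnorm : ∀ (x : M) (v : TangentSpace 𝓘(ℝ, E) x),
      ‖mfderiv 𝓘(ℝ, E) 𝓘(ℝ, E) p x v‖ = ‖v‖)
    {Γ : ℝ → M} {T : ℝ} (hT : 0 < T) (hΓ : ∀ s < T, ContinuousOn Γ (Icc 0 s)) {c w : E}
    (hl : ∀ t ∈ Ico 0 T, p (Γ t) = c + t • w) :
    ∃ γ : ℝ → M, ContinuousOn γ (Icc 0 T) ∧ γ 0 = Γ 0 ∧ ∀ t ∈ Icc 0 T, p (γ t) = c + t • w := by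
  have hdist : ∀ s t, 0 ≤ s → s ≤ t → t < T →
      edist (Γ s) (Γ t) ≤ ENNReal.ofReal (‖w‖ * (T - s)) := by
    intro s t hs hst ht
    refine (edist_le_of_lift_line hp hloc hnorm hst
      ((hΓ t ht).mono (Icc_subset_Icc_left hs))
      (fun u hu ↦ hl u ⟨hs.trans hu.1, hu.2.trans_lt ht⟩)).trans ?_
    gcongr
  have hcau : Cauchy (map Γ (𝓝[<] T)) := by
    refine EMetric.cauchy_iff.2 ⟨(inferInstance : (map Γ (𝓝[<] T)).NeBot).ne, fun ε hε ↦ ?_⟩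
    have hlim : Tendsto (fun s ↦ ENNReal.ofReal (‖w‖ * (T - s))) (𝓝[<] T) (𝓝 0) := by
      have : Continuous fun s ↦ ENNReal.ofReal (‖w‖ * (T - s)) :=
        ENNReal.continuous_ofReal.comp (by fun_prop)
      have h := (this.tendsto T).mono_left (nhdsWithin_le_nhds (s := Iio T))
      simpa using h
    refine ⟨_, image_mem_map (inter_mem (Ico_mem_nhdsLT hT) (hlim.eventually_lt_const hε)), ?_⟩
    rintro _ ⟨s, hs, rfl⟩ _ ⟨t, ht, rfl⟩
    rcases le_total s t with h | h
    · exact (hdist s t hs.1.1 h ht.1.2).trans_lt hs.2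
    · rw [edist_comm]
      exact (hdist t s ht.1.1 h hs.1.2).trans_lt ht.2
  obtain ⟨L, hL⟩ := CompleteSpace.complete hcau
  have hsub : 𝓝[Icc 0 T \ {T}] T ≤ 𝓝[<] T :=
    nhdsWithin_mono _ fun s hs ↦ lt_of_le_of_ne hs.1.2 hs.2
  refine ⟨Function.update Γ T L, fun t ht ↦ ?_, Function.update_of_ne hT.ne _ _, fun t ht ↦ ?_⟩
  · rcases ht.2.eq_or_lt with rfl | htT
    · exact continuousWithinAt_update_same.2 (Tendsto.mono_left hL hsub)
    · rw [continuousWithinAt_update_of_ne htT.ne]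
      obtain ⟨s, hts, hsT⟩ := exists_between htT
      refine (hΓ s hsT t ⟨ht.1, hts.le⟩).mono_of_mem_nhdsWithin ?_
      filter_upwards [self_mem_nhdsWithin, mem_nhdsWithin_of_mem_nhds (Iio_mem_nhds hts)]
        with u hu hus using ⟨hu.1, le_of_lt hus⟩
  · rcases ht.2.eq_or_lt with rfl | htT
    · rw [Function.update_self]
      refine tendsto_nhds_unique ((hp.continuous.tendsto L).comp hL) ?_
      have hc : Continuous fun s : ℝ ↦ c + s • w := by fun_prop
      refine ((hc.tendsto t).mono_left nhdsWithin_le_nhds).congr' ?_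
      filter_upwards [Ico_mem_nhdsLT hT] with s hs using (hl s hs).symm
    · rw [Function.update_of_ne htT.ne]
      exact hl t ⟨ht.1, htT⟩

/-- Segments lift through a local isometry defined on a complete manifold. -/
theorem exists_lift_line [CompleteSpace M] {p : M → E}
    (hp : ContMDiff 𝓘(ℝ, E) 𝓘(ℝ, E) ∞ p) (hloc : HasSmoothLocalInverses p)
    (hnorm : ∀ (x : M) (v : TangentSpace 𝓘(ℝ, E) x),
      ‖mfderiv 𝓘(ℝ, E) 𝓘(ℝ, E) p x v‖ = ‖v‖) (x : M) (w : E) :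
    ∃ γ : ℝ → M, ContinuousOn γ (Icc 0 1) ∧ γ 0 = x ∧
      ∀ t ∈ Icc (0 : ℝ) 1, p (γ t) = p x + t • w := by
  let S : Set ℝ := {T | ∃ γ : ℝ → M, ContinuousOn γ (Icc 0 T) ∧ γ 0 = x ∧
      ∀ t ∈ Icc 0 T, p (γ t) = p x + t • w}
  have hanti : ∀ s T, s ≤ T → T ∈ S → s ∈ S := by
    rintro s T hsT ⟨γ, hγ, h0, hl⟩
    exact ⟨γ, hγ.mono (Icc_subset_Icc_right hsT), h0, fun t ht ↦ hl t ⟨ht.1, ht.2.trans hsT⟩⟩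
  have h0S : (0 : ℝ) ∈ S := ⟨fun _ ↦ x, continuousOn_const, rfl, fun t ht ↦ by
    simp [le_antisymm ht.2 ht.1]⟩
  have hsup : ∀ T, 0 < T → (∀ s < T, s ∈ S) → T ∈ S := by
    intro T hT h
    have : Nonempty M := ⟨x⟩
    choose! γ hγ hγ0 hγl using h
    have hagree : ∀ s < T, EqOn (fun t ↦ γ t t) (γ s) (Icc 0 s) := by
      intro s hs t ht
      have hsub : Icc 0 t ⊆ Icc 0 s := Icc_subset_Icc_right ht.2
      have htT := ht.2.trans_lt hs
      refine (T2Space.isSeparatedMap p).eqOn_of_comp_eqOn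
        hloc.isLocalHomeomorph.isLocallyInjective isPreconnected_Icc (hγ t htT)
        ((hγ s hs).mono hsub) (fun u hu ↦ ?_) (left_mem_Icc.2 ht.1)
        ((hγ0 t htT).trans (hγ0 s hs).symm) (right_mem_Icc.2 ht.1)
      exact (hγl t htT u hu).trans (hγl s hs u (hsub hu)).symm
    obtain ⟨Γ, hΓ, hΓ0, hΓl⟩ := exists_lift_Icc_of_lift_Ico hp hloc hnorm hT
      (Γ := fun t ↦ γ t t) (c := p x) (w := w) (fun s hs ↦ (hγ s hs).congr (hagree s hs))
      (fun t ht ↦ hγl t ht.2 t (right_mem_Icc.2 ht.1))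
    exact ⟨Γ, hΓ, hΓ0.trans (hγ0 0 hT), hΓl⟩
  have hclosed : IsClosed (S ∩ Icc 0 1) := by
    refine isClosed_of_closure_subset fun T hT ↦ ?_
    have hT1 : T ∈ Icc (0 : ℝ) 1 := isClosed_Icc.closure_subset_iff.2 inter_subset_right hT
    refine ⟨?_, hT1⟩
    rcases hT1.1.eq_or_lt with rfl | hpos
    · exact h0S
    · refine hsup T hpos fun s hs ↦ ?_
      obtain ⟨u, hu, hsu⟩ := mem_closure_iff.1 hT (Ioi s) isOpen_Ioi hs
      exact hanti s u (le_of_lt hu) hsu.1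
  refine hclosed.Icc_subset_of_forall_exists_gt h0S ?_ (right_mem_Icc.2 zero_le_one)
  rintro T ⟨⟨γ, hγ, h0, hl⟩, hT⟩ y hy
  obtain ⟨T', hT', γ', hγ', h0', hl'⟩ :=
    exists_lift_extension hloc.isLocalHomeomorph hT.1 hy hγ hl
  exact ⟨T', ⟨γ', hγ', h0'.trans h0, hl'⟩, hT'⟩

/-- A local isometry from a complete manifold to its model space has a continuous section through
every point. -/
theorem exists_continuous_section [CompleteSpace M] {p : M → E}
    (hp : ContMDiff 𝓘(ℝ, E) 𝓘(ℝ, E) ∞ p) (hloc : HasSmoothLocalInverses p)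
    (hnorm : ∀ (x : M) (v : TangentSpace 𝓘(ℝ, E) x),
      ‖mfderiv 𝓘(ℝ, E) 𝓘(ℝ, E) p x v‖ = ‖v‖) (x : M) :
    ∃ σ : E → M, Continuous σ ∧ σ (p x) = x ∧ ∀ y, p (σ y) = y := by
  choose γ hγ hγ0 hγl using exists_lift_line hp hloc hnorm x
  have hsep := T2Space.isSeparatedMap p
  have hinj := hloc.isLocalHomeomorph.isLocallyInjective
  have hc : Continuous fun a : unitInterval × E ↦ γ (a.2 - p x) a.1 := by
    refine hloc.isLocalHomeomorph.continuous_lift hsep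
      ⟨fun a : unitInterval × E ↦ p x + (a.1 : ℝ) • (a.2 - p x), by fun_prop⟩ ?_ ?_ ?_
    · ext a
      exact hγl _ _ a.1.2
    · exact continuous_const.congr fun y ↦ (hγ0 (y - p x)).symm
    · intro y
      exact (hγ (y - p x)).comp_continuous continuous_subtype_val fun t ↦ t.2
  refine ⟨fun y ↦ γ (y - p x) 1, ?_, ?_, fun y ↦ ?_⟩
  · exact hc.comp (Continuous.prodMk_right (1 : unitInterval))
  · beta_reduce
    rw [sub_self]
    refine (hsep.constOn_of_comp hinj isPreconnected_Icc (hγ 0) (fun a ha b hb ↦ ?_)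
      (right_mem_Icc.2 zero_le_one) (left_mem_Icc.2 zero_le_one)).trans (hγ0 0)
    rw [hγl 0 a ha, hγl 0 b hb, smul_zero, smul_zero]
  · rw [hγl _ 1 (right_mem_Icc.2 zero_le_one)]
    simp

/-- A local isometry from a complete connected manifold to its model space is a diffeomorphism. -/
theorem exists_diffeomorph [CompleteSpace M] [ConnectedSpace M] {p : M → E}
    (hp : ContMDiff 𝓘(ℝ, E) 𝓘(ℝ, E) ∞ p) (hloc : HasSmoothLocalInverses p)
    (hnorm : ∀ (x : M) (v : TangentSpace 𝓘(ℝ, E) x),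
      ‖mfderiv 𝓘(ℝ, E) 𝓘(ℝ, E) p x v‖ = ‖v‖) :
    ∃ Φ : M ≃ₘ^∞⟮𝓘(ℝ, E), 𝓘(ℝ, E)⟯ E, ⇑Φ = p := by
  obtain ⟨x⟩ := (inferInstance : Nonempty M)
  obtain ⟨σ, hσ, hσx, hpσ⟩ := exists_continuous_section hp hloc hnorm x
  have hid : σ ∘ p = id :=
    (T2Space.isSeparatedMap p).eq_of_comp_eq hloc.isLocalHomeomorph.isLocallyInjective
      (hσ.comp hp.continuous) continuous_id (funext fun m ↦ hpσ (p m)) x hσx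
  have hpσ' : p ∘ σ = id := funext hpσ
  refine ⟨⟨⟨p, σ, congrFun hid, hpσ⟩, hp, fun y ↦ ?_⟩, rfl⟩
  refine hloc.contMDiffWithinAt_lift hσ.continuousWithinAt ?_
  change ContDiffWithinAt ℝ ∞ (p ∘ σ) univ y
  rw [hpσ']
  exact contDiff_id.contDiffWithinAt

/-- A smooth map from a complete connected manifold to its model space whose differentials preserve
inner products is a diffeomorphism. -/
theorem exists_diffeomorph_of_inner_mfderiv [FiniteDimensional ℝ E]
    [IsManifold 𝓘(ℝ, E) ∞ M] [CompleteSpace M] [ConnectedSpace M] {p : M → E} (hp : ContMDiff 𝓘(ℝ, E) 𝓘(ℝ, E) ∞ p)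
    (hinner : ∀ (x : M) (v w : TangentSpace 𝓘(ℝ, E) x),
      inner ℝ (mfderiv 𝓘(ℝ, E) 𝓘(ℝ, E) p x v) (mfderiv 𝓘(ℝ, E) 𝓘(ℝ, E) p x w) = inner ℝ v w) :
    ∃ Φ : M ≃ₘ^∞⟮𝓘(ℝ, E), 𝓘(ℝ, E)⟯ E, ⇑Φ = p := by
  have : CompleteSpace E := FiniteDimensional.complete ℝ E
  have hnorm : ∀ (x : M) (v : TangentSpace 𝓘(ℝ, E) x),
      ‖mfderiv 𝓘(ℝ, E) 𝓘(ℝ, E) p x v‖ = ‖v‖ := by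
    intro x v
    rw [norm_eq_sqrt_real_inner, norm_eq_sqrt_real_inner, hinner]
  refine exists_diffeomorph hp (hasSmoothLocalInverses_of_isInvertible_mfderiv hp fun x ↦ ?_) hnorm
  let L : E →L[ℝ] E := mfderiv 𝓘(ℝ, E) 𝓘(ℝ, E) p x
  have hL : Function.Injective L.toLinearMap := by
    refine (injective_iff_map_eq_zero _).2 fun v hv ↦ ?_
    exact norm_eq_zero (E := TangentSpace 𝓘(ℝ, E) x).1 ((hnorm x v).symm.trans
      ((congrArg (fun u : TangentSpace 𝓘(ℝ, E) (p x) ↦ ‖u‖) hv).trans norm_zero))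
  exact ⟨(LinearEquiv.ofInjectiveEndo L.toLinearMap hL).toContinuousLinearEquiv, by ext; rfl⟩

end Lifting

end LocalIsometry
namespace SingularSemiEuclidean

attribute [local instance 2000] chartedSpaceSelf

/-- The projection `(x, y, z) ↦ (x, y)`. -/
def planeProjection : R021 →L[ℝ] EuclideanSpace ℝ (Fin 2) :=
  LinearMap.toContinuousLinearMap
    { toFun := fun v ↦ !₂[v 0, v 1]
      map_add' := fun v w ↦ by ext i; fin_cases i <;> simp
      map_smul' := fun c v ↦ by ext i; fin_cases i <;> simp }

theorem planeProjection_apply (v : R021) : planeProjection v = !₂[v 0, v 1] := rfl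

theorem inner_planeProjection (p v w : R021) :
    inner ℝ (planeProjection v) (planeProjection w) = degenerateMetric p v w := by
  simp [planeProjection_apply, degenerateMetric, PiLp.inner_apply, Fin.sum_univ_two, mul_comm]

variable {M : Type*} [TopologicalSpace M] [ChartedSpace (EuclideanSpace ℝ (Fin 2)) M]
  [RiemannianBundle (fun x : M ↦ TangentSpace (𝓡 2) x)]

theorem IsIsometricImmersion.contMDiff_planeProjection {f : M → R021}
    (hf : IsIsometricImmersion f) : ContMDiff (𝓡 2) (𝓡 2) ∞ (planeProjection ∘ f) :=
  planeProjection.contMDiff.comp hf.contMDiff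

/-- The projection of an isometric immersion into `ℝ^{0,2,1}` to the plane preserves the metric. -/
theorem IsIsometricImmersion.inner_mfderiv_planeProjection {f : M → R021}
    (hf : IsIsometricImmersion f) (x : M) (v w : TangentSpace (𝓡 2) x) :
    inner ℝ (mfderiv (𝓡 2) (𝓡 2) (planeProjection ∘ f) x v)
      (mfderiv (𝓡 2) (𝓡 2) (planeProjection ∘ f) x w) = inner ℝ v w := by
  have h : mfderiv (𝓡 2) (𝓡 2) (planeProjection ∘ f) x =
      planeProjection.comp (mfderiv (𝓡 2) (𝓡 3) f x) := by
    rw [mfderiv_comp x planeProjection.mdifferentiableAt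
      ((hf.contMDiff x).mdifferentiableAt (by simp)), planeProjection.mfderiv_eq]
    rfl
  rw [h, ← hf.pullback_eq x v w]
  exact inner_planeProjection (f x) _ _

end SingularSemiEuclidean

end

theorem theorem4p3p1 {M : Type*} [EMetricSpace M] [ChartedSpace (EuclideanSpace ℝ (Fin 2)) M]
    [IsManifold (𝓡 2) ∞ M] [RiemannianBundle (fun x : M ↦ TangentSpace (𝓡 2) x)]
    [IsContMDiffRiemannianBundle (𝓡 2) ∞ (EuclideanSpace ℝ (Fin 2))
      (fun x : M ↦ TangentSpace (𝓡 2) x)]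
    [IsRiemannianManifold (𝓡 2) M] [ConnectedSpace M] [CompleteSpace M]
    (f : M → SingularSemiEuclidean.R021) (hf : SingularSemiEuclidean.IsIsometricImmersion f) :
    SingularSemiEuclidean.IsIsometricToEuclideanPlane M ∧
      ∃ F : EuclideanSpace ℝ (Fin 2) → ℝ,
        ContDiff ℝ ∞ F ∧ Set.range f = SingularSemiEuclidean.entireGraph F := by
  obtain ⟨Φ, hΦ⟩ := LocalIsometry.exists_diffeomorph_of_inner_mfderiv
    hf.contMDiff_planeProjection hf.inner_mfderiv_planeProjection
  refine ⟨⟨Φ, fun x v w ↦ ?_⟩, fun q ↦ f (Φ.symm q) 2, ?_, ?_⟩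
  · rw [hΦ]
    exact hf.inner_mfderiv_planeProjection x v w
  · have h : ContDiff ℝ ∞ (f ∘ Φ.symm) := (hf.contMDiff.comp Φ.symm.contMDiff).contDiff
    exact (EuclideanSpace.proj (2 : Fin 3) : SingularSemiEuclidean.R021 →L[ℝ] ℝ).contDiff.comp h
  · have hΦf : ∀ m, Φ m = !₂[f m 0, f m 1] := fun m ↦ congrFun hΦ m
    ext q
    constructor
    · rintro ⟨m, rfl⟩
      refine ⟨f m 0, f m 1, ?_⟩
      beta_reduce
      rw [← hΦf, Φ.symm_apply_apply]
      ext i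
      fin_cases i <;> rfl
    · rintro ⟨u, v, rfl⟩
      refine ⟨Φ.symm !₂[u, v], ?_⟩
      have h := hΦf (Φ.symm !₂[u, v])
      rw [Φ.apply_symm_apply] at h
      have h0 : u = f (Φ.symm !₂[u, v]) 0 := congrArg (fun z ↦ z 0) h
      have h1 : v = f (Φ.symm !₂[u, v]) 1 := congrArg (fun z ↦ z 1) h
      ext i
      fin_cases i
      · exact h0.symm
      · exact h1.symm
      · rfl
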